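/- Let $d,d_R,t,r_{\max}$ be natural numbers, $\mathcal H_X=\mathbb C^d$, $\mathcal H_R=\mathbb C^{d_R}$. A state $|\psi\rangle\in\mathcal H_X\otimes\mathcal H_R$ (a unit vector) has a Schmidt decomposition $|\psi\rangle=\sum_{k=1}^{r}\sqrt{c_k}\,|\xi_k\rangle|\zeta_k\rangle$ with $c_k>0$, $\sum_k c_k=1$ and $(\xi_k)\subset\mathcal H_X$, $(\zeta_k)\subset\mathcal H_R$ orthonormal; $r$ is its Schmidt rank and the $\xi_k$ are its Schmidt vectors. For unitaries $U,V\in\mathcal U(d)$ the risk is $R_U(V)=\int D\big(U|x\rangle\langle x|U^\dagger,\,V|x\rangle\langle x|V^\dagger\big)^2\,dx$, where $x$ is uniformly distributed on the unit sphere of $\mathcal H_X$ and $D(\rho,\sigma)=\tfrac12\mathrm{Tr}|\rho-\sigma|$ is the trace distance. Training inputs $S_{\mathrm{in}}=(\psi_1,\dots,\psi_t)$ together with a target unitary $U$ give the training samples $S=\big((\psi_j,\phi_j)\big)_{j=1}^t$, $\phi_j=(U\otimes I)\psi_j$. A training algorithm is a measurable map $S\mapsto V_S\in\mathcal U(d)$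 depending on the training samples only. Let $U$ be distributed according to the Haar probability measure on $\mathcal U(d)$ and, independently, let $S_{\mathrm{in}}$ be distributed according to any probability measure under which almost surely the largest Schmidt rank of $\psi_1,\dots,\psi_t$ is $r_{\max}$ and every Schmidt vector of every $\psi_j$ lies in the span of the Schmidt vectors of one input of Schmidt rank $r_{\max}$. Suppose that training is perfect, i.e. for almost all $U$ and $S_{\mathrm{in}}$ the loss $1-\frac1t\sum_{j=1}^t|\langle\phi_j|(V_S\otimes I)|\psi_j\rangle|^2$ is $0$. Then $$\mathbb E_U\big[\mathbb E_{S}[R_U(V_S)]\big]\;\ge\;1-\frac{r_{\max}^2+d+1}{d(d+1)} .$$ In particular the bound is the same for every number of samples $t$. -/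

import Mathlib

open MeasureTheory
open scoped Matrix Kronecker

noncomputable section

namespace QNFL

/-- The space `ℂ^d` of the input register `X`. -/
abbrev HX (d : ℕ) := EuclideanSpace ℂ (Fin d)

/-- The composite space `ℂ^d ⊗ ℂ^dR` of the input register and the reference system, with
coordinates indexed by pairs of basis labels. -/
abbrev HXR (d dR : ℕ) := EuclideanSpace ℂ (Fin d × Fin dR)

/-- The unitary group `U(d)`. -/
abbrev UGroup (d : ℕ) := Matrix.unitaryGroup (Fin d) ℂ

/-- The Borel sigma-algebra of the unitary group. -/
instance instMeasurableSpaceUGroup (d : ℕ) : MeasurableSpace (UGroup d) := borel _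

instance instBorelSpaceUGroup (d : ℕ) : BorelSpace (UGroup d) := ⟨rfl⟩

instance instCompactSpaceUGroup (d : ℕ) : CompactSpace (UGroup d) := by
  have hsub : ((UGroup d : Set (Matrix (Fin d) (Fin d) ℂ))) ⊆
      Set.pi Set.univ (fun _ => Set.pi Set.univ (fun _ => Metric.closedBall (0 : ℂ) 1)) := by
    intro U hU i _ j _
    rw [mem_closedBall_zero_iff]
    exact entry_norm_bound_of_unitary hU i j
  have hK : IsCompact (Set.pi Set.univ
      (fun _ : Fin d => Set.pi Set.univ (fun _ : Fin d => Metric.closedBall (0 : ℂ) 1))) :=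
    isCompact_univ_pi fun _ => isCompact_univ_pi fun _ => isCompact_closedBall _ _
  have hcl : IsClosed ((UGroup d : Set (Matrix (Fin d) (Fin d) ℂ))) := by
    have : (UGroup d : Set (Matrix (Fin d) (Fin d) ℂ)) = {A | A * star A = 1} := by
      ext A
      exact Matrix.mem_unitaryGroup_iff
    rw [this]
    exact isClosed_eq (by fun_prop) continuous_const
  exact isCompact_iff_compactSpace.mp (hK.of_isClosed_subset hcl hsub)

/-- The Haar probability measure on `U(d)`. -/
def haarU (d : ℕ) : Measure (UGroup d) := Measure.haarMeasure ⊤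

/-- The uniform probability distribution on the unit vectors of `ℂ^d`: the normalized surface
measure of the unit sphere. -/
def uniformState (d : ℕ) : Measure (Metric.sphere (0 : HX d) 1) :=
  ((volume : Measure (HX d)).toSphere Set.univ)⁻¹ • (volume : Measure (HX d)).toSphere

/-- The action `|x⟩ ↦ A|x⟩` of a square matrix. -/
def applyMat {ι : Type*} [Fintype ι] (A : Matrix ι ι ℂ) (x : EuclideanSpace ℂ ι) :
    EuclideanSpace ℂ ι :=
  WithLp.toLp 2 (A *ᵥ x.ofLp)

/-- The action `|ψ⟩ ↦ (U ⊗ I)|ψ⟩` of a unitary on the first register. -/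
def applyX {d dR : ℕ} (U : UGroup d) (ψ : HXR d dR) : HXR d dR :=
  applyMat ((U : Matrix (Fin d) (Fin d) ℂ) ⊗ₖ (1 : Matrix (Fin dR) (Fin dR) ℂ)) ψ

/-- The rank one operator `|y⟩⟨y|`. -/
def ketbra {ι : Type*} (y : EuclideanSpace ℂ ι) : Matrix ι ι ℂ :=
  Matrix.vecMulVec y.ofLp (star y.ofLp)

/-- The trace distance `D(ρ, σ) = 1/2 Tr |ρ - σ|`, where `|A| = √(A† A)`. -/
def traceDist {d : ℕ} (ρ σ : Matrix (Fin d) (Fin d) ℂ) : ℝ :=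
  1 / 2 * (cfc Real.sqrt ((ρ - σ)ᴴ * (ρ - σ))).trace.re

/-- The risk `R_U(V)`: the mean squared trace distance between the outputs `U|x⟩` and `V|x⟩` over
uniformly random states `|x⟩`. -/
def risk {d : ℕ} (U V : UGroup d) : ℝ :=
  ∫ x, (traceDist (ketbra (applyMat (U : Matrix (Fin d) (Fin d) ℂ) x))
    (ketbra (applyMat (V : Matrix (Fin d) (Fin d) ℂ) x))) ^ 2 ∂(uniformState d)

/-- The product state `|ξ⟩|ζ⟩`. -/
def prodState {d dR : ℕ} (ξ : HX d) (ζ : EuclideanSpace ℂ (Fin dR)) : HXR d dR :=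
  WithLp.toLp 2 fun p => ξ p.1 * ζ p.2

/-- A Schmidt decomposition `|ψ⟩ = ∑ₖ √cₖ |ξₖ⟩|ζₖ⟩` of a (normalized) state; `rank` is the Schmidt
rank and the `ξ k` are the Schmidt vectors in the input register. -/
structure SchmidtDecomposition {d dR : ℕ} (ψ : HXR d dR) where
  rank : ℕ
  coeff : Fin rank → ℝ
  ξ : Fin rank → HX d
  ζ : Fin rank → EuclideanSpace ℂ (Fin dR)
  coeff_pos : ∀ k, 0 < coeff k
  coeff_sum : ∑ k, coeff k = 1
  orthonormal_ξ : Orthonormal ℂ ξ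
  orthonormal_ζ : Orthonormal ℂ ζ
  decomp : ψ = ∑ k, ((Real.sqrt (coeff k) : ℝ) : ℂ) • prodState (ξ k) (ζ k)

/-- The training inputs `ψ₁, …, ψₜ` are states, the largest of their Schmidt ranks is `r`, and
every Schmidt vector of every input lies in the span of the Schmidt vectors of one input of Schmidt
rank `r`. -/
def IsMinimalSpan {d dR t : ℕ} (r : ℕ) (ψ : Fin t → HXR d dR) : Prop :=
  ∃ D : ∀ j, SchmidtDecomposition (ψ j), ∃ m : Fin t,
    (D m).rank = r ∧ (∀ j, (D j).rank ≤ r) ∧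
    ∀ j k, (D j).ξ k ∈ Submodule.span ℂ (Set.range (D m).ξ)

/-- The training samples `(ψⱼ, (U ⊗ I) ψⱼ)` for the target unitary `U`. -/
def trainingSet {d dR t : ℕ} (U : UGroup d) (ψ : Fin t → HXR d dR) :
    Fin t → HXR d dR × HXR d dR :=
  fun j => (ψ j, applyX U (ψ j))

/-- The loss of the hypothesis `V` on the training samples `(ψⱼ, φⱼ)`:
`1 - 1/t ∑ⱼ |⟨φⱼ|(V ⊗ I)|ψⱼ⟩|²`. -/
def loss {d dR t : ℕ} (S : Fin t → HXR d dR × HXR d dR) (V : UGroup d) : ℝ :=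
  1 - 1 / (t : ℝ) * ∑ j, ‖inner ℂ (S j).2 (applyX V (S j).1)‖ ^ 2

end QNFL

end

open QNFL

/-! Write `W = Uᴴ V`. Since `traceDist_ketbra_sq` gives `D² = 1 - |⟨x|W x⟩|²` for pure states, the
fourth moments of a random state turn the risk into `1 - (|tr W|² + d) / (d (d + 1))` (`risk_eq`).
What has to be shown is that the mean of `|tr W|²` is at most `r² + 1`.

Perfect training forces `V ψ = z U ψ` with `|z| = 1` for the input of largest Schmidt rank. Its
Schmidt coefficients are positive, so `W ξ = z ξ` with one common phase on its `r` Schmidt vectors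
(`applyMat_ξ_of_applyX`). Conversely, a unitary `M` fixing these vectors fixes every training input,
so `U` and `U M` produce the same samples and the same hypothesis (`trainingSet_mul_eq`): on the
orthogonal complement the algorithm has no information about `U`.

By right invariance of Haar measure, `|tr W|²` may be averaged over such `M`, that is, replaced by
the mean of `|tr (Mᴴ W)|²`. A finite family suffices: signed cyclic shifts of an orthonormal basis
of the `n`-dimensional complement. The trace is `r z` plus a signed sum of entries of `W`; the signs
remove all cross terms (`sum_signs_normSq`), and the shifts run through each column once, so
Bessel's inequality bounds the rest by 1 on average (`sum_normSq_trace_twist_le`). Only the span of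
the Schmidt vectors enters, which is why `t` does not appear. Fubini extends the bound from fixed to
random inputs. -/

namespace QNFL

/-! ### The uniform measure on the sphere and its invariance. -/

open Set Pointwise in
/-- The surface measure of the unit sphere is invariant under linear isometries. -/
theorem measurePreserving_toSphere {E : Type*} [NormedAddCommGroup E] [InnerProductSpace ℝ E]
    [FiniteDimensional ℝ E] [MeasurableSpace E] [BorelSpace E] (e : E ≃ₗᵢ[ℝ] E) :
    MeasurePreserving (fun x : Metric.sphere (0 : E) 1 =>
        (⟨e x, by simp⟩ : Metric.sphere (0 : E) 1))
      (volume : Measure E).toSphere (volume : Measure E).toSphere := by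
  have hc : Continuous (fun x : Metric.sphere (0 : E) 1 =>
      (⟨e x, by simp⟩ : Metric.sphere (0 : E) 1)) := by fun_prop
  refine ⟨hc.measurable, ?_⟩
  ext A hA
  rw [Measure.map_apply hc.measurable hA, Measure.toSphere_apply' _ (hc.measurable hA),
    Measure.toSphere_apply' _ hA]
  congr 1
  -- The surface measure of `A` is, up to the dimension factor, the volume of the cone over `A`; an
  -- isometry maps cones to cones and preserves volume.
  have key : Ioo (0 : ℝ) 1 • (Subtype.val '' ((fun x : Metric.sphere (0 : E) 1 =>
      (⟨e x, by simp⟩ : Metric.sphere (0 : E) 1)) ⁻¹' A)) =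
      e ⁻¹' (Ioo (0 : ℝ) 1 • (Subtype.val '' A)) := by
    ext y
    simp only [Set.mem_smul, Set.mem_image, Set.mem_preimage]
    constructor
    · rintro ⟨c, hc, z, ⟨x, hx, rfl⟩, rfl⟩
      exact ⟨c, hc, e x, ⟨_, hx, rfl⟩, by simp⟩
    · rintro ⟨c, hc, z, ⟨x, hx, rfl⟩, h⟩
      refine ⟨c, hc, e.symm x, ⟨⟨e.symm x, by simp⟩, by simpa using hx, rfl⟩, ?_⟩
      apply e.injective
      simp [h]
  rw [key]
  exact (LinearIsometryEquiv.measurePreserving e).measure_preimage_emb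
    e.toHomeomorph.measurableEmbedding _

/-- For `d = 0` the unit sphere is empty and `uniformState` is the zero measure, hence `NeZero d`.
-/
instance instIsProbabilityMeasureUniformState (d : ℕ) [NeZero d] :
    IsProbabilityMeasure (uniformState d) := by
  refine ⟨?_⟩
  have : Nontrivial (HX d) := by
    have : Nonempty (Fin d) := ⟨0⟩
    infer_instance
  rw [uniformState, Measure.smul_apply, smul_eq_mul]
  refine ENNReal.inv_mul_cancel ?_ (measure_ne_top _ _)
  exact Measure.measure_univ_ne_zero.mpr (Measure.toSphere_ne_zero (volume : Measure (HX d)))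

theorem integral_uniformState_comp {d : ℕ} (T : HX d →ₗᵢ[ℝ] HX d) {f : HX d → ℂ}
    (hf : Continuous f) :
    ∫ x, f (T x) ∂(uniformState d) = ∫ x, f x ∂(uniformState d) := by
  have h := measurePreserving_toSphere (T.toLinearIsometryEquiv rfl)
  unfold uniformState
  rw [integral_smul_measure, integral_smul_measure]
  congr 1
  conv_rhs => rw [← h.map_eq]
  rw [integral_map h.measurable.aemeasurable (by fun_prop)]
  rfl

theorem integrable_uniformState {d : ℕ} [NeZero d] {f : HX d → ℂ} (hf : Continuous f) :
    Integrable (fun x : Metric.sphere (0 : HX d) 1 => f x) (uniformState d) :=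
  (hf.comp continuous_subtype_val).integrable_of_hasCompactSupport
    (HasCompactSupport.of_compactSpace _)

/-! ### Fourth moments of a random state. -/

open scoped ComplexConjugate

/-- The monomial `x̄ᵢ xⱼ xₖ x̄ₗ` in the coordinates of a state. -/
noncomputable def monomial {d : ℕ} (i j k l : Fin d) (x : HX d) : ℂ :=
  conj (x i) * x j * x k * conj (x l)

theorem continuous_monomial {d : ℕ} (i j k l : Fin d) : Continuous (monomial i j k l) := by
  unfold monomial
  have := Complex.continuous_conj
  fun_prop

/-- The fourth moments of a uniformly random state. -/
noncomputable def moment (d : ℕ) (i j k l : Fin d) : ℂ :=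
  ∫ x : Metric.sphere (0 : HX d) 1, monomial i j k l x ∂(uniformState d)

theorem integrable_monomial {d : ℕ} [NeZero d] (i j k l : Fin d) :
    Integrable (fun x : Metric.sphere (0 : HX d) 1 => monomial i j k l x) (uniformState d) :=
  integrable_uniformState (continuous_monomial i j k l)

/-- Multiplication of one coordinate by the imaginary unit. -/
noncomputable def phaseIsometry {d : ℕ} (p : Fin d) : HX d →ₗᵢ[ℝ] HX d where
  toFun x := WithLp.toLp 2 fun i => (if i = p then Complex.I else 1) * x i
  map_add' x y := by ext i; simp [mul_add]
  map_smul' c x := by ext i; simp [mul_left_comm]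
  norm_map' x := by
    rw [EuclideanSpace.norm_eq, EuclideanSpace.norm_eq]
    congr 1
    refine Finset.sum_congr rfl fun i _ => ?_
    by_cases h : i = p <;> simp [h]

/-- Exchange of two coordinates. -/
noncomputable def swapIsometry {d : ℕ} (i j : Fin d) : HX d →ₗᵢ[ℝ] HX d where
  toFun x := WithLp.toLp 2 fun k => x (Equiv.swap i j k)
  map_add' x y := by ext k; simp
  map_smul' c x := by ext k; simp
  norm_map' x := by
    rw [EuclideanSpace.norm_eq, EuclideanSpace.norm_eq]
    congr 1
    exact Equiv.sum_comp (Equiv.swap i j) (fun k => ‖x k‖ ^ 2)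

/-- The Hadamard transformation of two coordinates. -/
noncomputable def hadamardIsometry {d : ℕ} {i j : Fin d} (hij : i ≠ j) : HX d →ₗᵢ[ℝ] HX d where
  toFun x := WithLp.toLp 2 fun k =>
    if k = i then ((√2 : ℝ) : ℂ)⁻¹ * (x i + x j)
    else if k = j then ((√2 : ℝ) : ℂ)⁻¹ * (x i - x j) else x k
  map_add' x y := by
    ext k
    change (if k = i then ((√2 : ℝ) : ℂ)⁻¹ * ((x i + y i) + (x j + y j))
      else if k = j then ((√2 : ℝ) : ℂ)⁻¹ * ((x i + y i) - (x j + y j)) else x k + y k) =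
      (if k = i then ((√2 : ℝ) : ℂ)⁻¹ * (x i + x j)
      else if k = j then ((√2 : ℝ) : ℂ)⁻¹ * (x i - x j) else x k) +
      (if k = i then ((√2 : ℝ) : ℂ)⁻¹ * (y i + y j)
      else if k = j then ((√2 : ℝ) : ℂ)⁻¹ * (y i - y j) else y k)
    split_ifs <;> ring
  map_smul' c x := by
    ext k
    change (if k = i then ((√2 : ℝ) : ℂ)⁻¹ * (c * x i + c * x j)
      else if k = j then ((√2 : ℝ) : ℂ)⁻¹ * (c * x i - c * x j) else c * x k) =
      c * (if k = i then ((√2 : ℝ) : ℂ)⁻¹ * (x i + x j)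
      else if k = j then ((√2 : ℝ) : ℂ)⁻¹ * (x i - x j) else x k)
    split_ifs <;> ring
  norm_map' x := by
    rw [EuclideanSpace.norm_eq, EuclideanSpace.norm_eq]
    congr 1
    change ∑ k, ‖if k = i then ((√2 : ℝ) : ℂ)⁻¹ * (x i + x j)
      else if k = j then ((√2 : ℝ) : ℂ)⁻¹ * (x i - x j) else x k‖ ^ 2 = _
    rw [← sub_eq_zero, ← Finset.sum_sub_distrib, Fintype.sum_eq_add i j hij]
    · simp only [if_true, if_neg hij.symm, norm_mul, norm_inv, Complex.norm_real, mul_pow,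
        inv_pow, Real.norm_eq_abs, sq_abs]
      rw [Real.sq_sqrt (by norm_num)]
      simp only [← Complex.normSq_eq_norm_sq, Complex.normSq_add, Complex.normSq_sub]
      ring
    · rintro k ⟨h1, h2⟩
      simp [h1, h2]

theorem moment_phase {d : ℕ} (p i j k l : Fin d) :
    moment d i j k l = conj (if i = p then Complex.I else 1) * (if j = p then Complex.I else 1) *
      (if k = p then Complex.I else 1) * conj (if l = p then Complex.I else 1) *
      moment d i j k l := by
  conv_lhs => rw [moment, ← integral_uniformState_comp (phaseIsometry p)
    (continuous_monomial i j k l)]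
  rw [moment, ← integral_const_mul]
  congr 1
  ext x
  simp only [monomial, phaseIsometry, LinearIsometry.coe_mk, LinearMap.coe_mk, AddHom.coe_mk, map_mul]
  ring

/-- Multiplying the coordinate `p` by `I` multiplies the moment by a power of `I`, the exponent
being the number of `p` among `j, k` minus the number among `i, l`. Outside the two pairings some
`p` has an exponent that is nonzero and at most 2 in absolute value, so the factor is not 1. -/
theorem moment_eq_zero {d : ℕ} {i j k l : Fin d} (h1 : ¬ (i = j ∧ k = l))
    (h2 : ¬ (i = k ∧ j = l)) : moment d i j k l = 0 := by
  have aux : ∀ c : ℂ, c ≠ 1 → ∀ m : ℂ, m = c * m → m = 0 := by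
    intro c hc m hm
    have : (1 - c) * m = 0 := by linear_combination hm
    exact (mul_eq_zero.mp this).resolve_left (sub_ne_zero.mpr hc.symm)
  have hI : Complex.I ≠ 1 := fun h => by simpa using congrArg Complex.im h
  have hI' : -Complex.I ≠ 1 := fun h => by simpa using congrArg Complex.im h
  have hn : (-1 : ℂ) ≠ 1 := by norm_num
  have hi := moment_phase i i j k l
  have hj := moment_phase j i j k l
  have hk := moment_phase k i j k l
  by_cases hji : j = i
  · subst hji
    by_cases hkj : k = j
    · subst hkj
      have hl : l ≠ k := fun h => h1 ⟨rfl, h.symm⟩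
      simp only [if_true, if_neg hl, Complex.conj_I, map_one] at hi
      exact aux _ (by simpa using hI) _ hi
    · have hkl : l ≠ k := fun h => h1 ⟨rfl, h.symm⟩
      simp only [if_true, if_neg hkl, if_neg (Ne.symm hkj), map_one] at hk
      exact aux _ (by simpa using hI) _ hk
  · by_cases hki : k = i
    · subst hki
      have hl : l ≠ j := fun h => h2 ⟨rfl, h.symm⟩
      simp only [if_true, if_neg hl, if_neg (Ne.symm hji), map_one] at hj
      exact aux _ (by simpa using hI) _ hj
    · by_cases hl : l = i
      · simp only [if_true, if_neg hji, if_neg hki, if_pos hl, Complex.conj_I] at hi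
        exact aux _ (by simpa using hn) _ hi
      · simp only [if_true, if_neg hji, if_neg hki, if_neg hl, Complex.conj_I, map_one] at hi
        exact aux _ (by simpa using hI') _ hi

theorem moment_self_eq {d : ℕ} (i j : Fin d) : moment d i i i i = moment d j j j j := by
  conv_lhs => rw [moment, ← integral_uniformState_comp (swapIsometry i j)
    (continuous_monomial i i i i)]
  simp [moment, monomial, swapIsometry]

/-- The Hadamard isometry turns `|xᵢ|² |xⱼ|²` into `|xᵢ² - xⱼ²|² / 4`. The mixed terms of the
expansion have zero mean, and the two fourth powers have equal means. -/
theorem moment_pair {d : ℕ} [NeZero d] {i j : Fin d} (hij : i ≠ j) :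
    moment d i i j j = moment d i i i i / 2 := by
  have h : moment d i i j j = (moment d i i i i + moment d j j j j - moment d i j j i
      - moment d j i i j) / 4 := by
    conv_lhs => rw [moment, ← integral_uniformState_comp (hadamardIsometry hij)
      (continuous_monomial i i j j)]
    have hpt : ∀ x : HX d, monomial i i j j (hadamardIsometry hij x) =
        (monomial i i i i x + monomial j j j j x - monomial i j j i x - monomial j i i j x) / 4 := by
      intro x
      have hs : ((√2 : ℝ) : ℂ)⁻¹ ^ 2 = 1 / 2 := by
        rw [inv_pow, ← Complex.ofReal_pow, Real.sq_sqrt (by norm_num)]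
        norm_num
      have hi : hadamardIsometry hij x i = ((√2 : ℝ) : ℂ)⁻¹ * (x i + x j) := by
        simp [hadamardIsometry]
      have hj : hadamardIsometry hij x j = ((√2 : ℝ) : ℂ)⁻¹ * (x i - x j) := by
        simp [hadamardIsometry, hij.symm]
      simp only [monomial, hi, hj, map_mul, map_add, map_sub, map_inv₀, Complex.conj_ofReal]
      generalize ((√2 : ℝ) : ℂ)⁻¹ = s at hs
      have hs4 : s ^ 4 = 1 / 4 := by
        calc s ^ 4 = (s ^ 2) ^ 2 := by ring
          _ = 1 / 4 := by rw [hs]; norm_num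
      generalize x i = a
      generalize x j = b
      linear_combination
        ((conj a + conj b) * (a + b) * (a - b) * (conj a - conj b)) * hs4
    simp_rw [hpt]
    have h1 := integrable_monomial i i i i
    have h2 := integrable_monomial j j j j
    have h3 := integrable_monomial i j j i
    have h4 := integrable_monomial j i i j
    have h12 : Integrable (fun x : Metric.sphere (0 : HX d) 1 =>
      monomial i i i i (x : HX d) + monomial j j j j (x : HX d)) (uniformState d) := h1.add h2
    have h123 : Integrable (fun x : Metric.sphere (0 : HX d) 1 => monomial i i i i (x : HX d) +
      monomial j j j j (x : HX d) - monomial i j j i (x : HX d)) (uniformState d) := h12.sub h3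
    rw [integral_div, integral_sub h123 h4, integral_sub h12 h3, integral_add h1 h2]
    rfl
  rw [h, moment_self_eq j i, moment_eq_zero (i := i) (j := j) (by simp [hij]) (by simp [hij]),
    moment_eq_zero (i := j) (j := i) (by simp [hij.symm]) (by simp [hij.symm])]
  ring

theorem sum_normSq_sphere {d : ℕ} (x : Metric.sphere (0 : HX d) 1) :
    ∑ i, conj ((x : HX d) i) * (x : HX d) i = 1 := by
  have h : ‖(x : HX d)‖ ^ 2 = 1 := by simp
  rw [EuclideanSpace.norm_sq_eq] at h
  simp_rw [Complex.conj_mul']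
  exact_mod_cast h

theorem moment_eq {d : ℕ} [NeZero d] (i j k l : Fin d) :
    moment d i j k l = 1 / (d * (d + 1)) *
      ((if i = j ∧ k = l then 1 else 0) + if i = k ∧ j = l then 1 else 0) := by
  have h0 : ∀ i j : Fin d, moment d i i j j =
      moment d 0 0 0 0 / 2 * (1 + if i = j then 1 else 0) := by
    intro i j
    by_cases hij : i = j
    · subst hij
      simp [moment_self_eq i 0]
      ring
    · rw [moment_pair hij, if_neg hij, moment_self_eq i 0]
      ring
  -- Normalization: integrating `(∑ |xᵢ|²)² = 1` fixes the one remaining constant through `A (d² +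
  -- d) = 1`.
  have hsum : ∑ i, ∑ j, moment d i i j j = 1 := by
    have : ∑ i, ∑ j, moment d i i j j = ∫ x : Metric.sphere (0 : HX d) 1,
        ∑ i, ∑ j, monomial i i j j (x : HX d) ∂(uniformState d) := by
      rw [integral_finsetSum]
      · refine Finset.sum_congr rfl fun i _ => ?_
        rw [integral_finsetSum]
        · rfl
        · exact fun j _ => integrable_monomial _ _ _ _
      · exact fun i _ => integrable_finsetSum _ fun j _ =>
          integrable_monomial _ _ _ _
    rw [this]
    have h1 : ∀ x : Metric.sphere (0 : HX d) 1,
        ∑ i, ∑ j, monomial i i j j (x : HX d) = 1 := by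
      intro x
      unfold monomial
      simp_rw [mul_assoc, ← Finset.mul_sum, ← mul_assoc]
      rw [← Finset.sum_mul, sum_normSq_sphere, one_mul]
      rw [← sum_normSq_sphere x]
      exact Finset.sum_congr rfl fun i _ => mul_comm _ _
    simp [h1]
  generalize moment d 0 0 0 0 / 2 = A at h0
  have hd : (d : ℂ) ≠ 0 := Nat.cast_ne_zero.mpr (NeZero.ne d)
  have hd1 : (d : ℂ) + 1 ≠ 0 := by exact_mod_cast d.succ_ne_zero
  have hA : A = 1 / (d * (d + 1)) := by
    simp_rw [h0, ← Finset.mul_sum, Finset.sum_add_distrib] at hsum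
    simp at hsum
    field_simp
    linear_combination hsum
  by_cases h1 : i = j ∧ k = l
  · obtain ⟨rfl, rfl⟩ := h1
    rw [h0, hA]
    simp
  by_cases h2 : i = k ∧ j = l
  · obtain ⟨rfl, rfl⟩ := h2
    have : moment d i j i j = moment d i i j j := by
      simp only [moment, monomial]
      congr 1
      ext x
      ring
    have hij : i ≠ j := fun h => h1 ⟨h, h⟩
    rw [this, h0, hA]
    simp [hij]
  · rw [moment_eq_zero h1 h2]
    simp [h1, h2]

/-- The mean squared modulus of the expectation value of an operator in a random state. -/
theorem integral_expectation_normSq {d : ℕ} [NeZero d] (W : Matrix (Fin d) (Fin d) ℂ) :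
    ∫ x : Metric.sphere (0 : HX d) 1, ((‖inner ℂ (x : HX d) (applyMat W x)‖ ^ 2 : ℝ) : ℂ)
      ∂(uniformState d) =
      1 / (d * (d + 1)) * (W.trace * conj W.trace + (W * Wᴴ).trace) := by
  have hpt : ∀ x : Metric.sphere (0 : HX d) 1,
      ((‖inner ℂ (x : HX d) (applyMat W x)‖ ^ 2 : ℝ) : ℂ) =
      ∑ i, ∑ j, ∑ k, ∑ l, W i j * conj (W k l) * monomial i j k l (x : HX d) := by
    intro x
    have h1 : inner ℂ (x : HX d) (applyMat W x) =
        ∑ i, ∑ j, conj ((x : HX d) i) * (W i j * (x : HX d) j) := by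
      simp only [PiLp.inner_apply, applyMat, RCLike.inner_apply, Matrix.mulVec, dotProduct,
        Finset.sum_mul]
      refine Finset.sum_congr rfl fun i _ => Finset.sum_congr rfl fun j _ => ?_
      ring
    rw [Complex.ofReal_pow, ← Complex.mul_conj', h1]
    simp only [map_sum, map_mul, Complex.conj_conj]
    rw [Finset.sum_mul]
    refine Finset.sum_congr rfl fun i _ => ?_
    rw [Finset.sum_mul]
    refine Finset.sum_congr rfl fun j _ => ?_
    rw [Finset.mul_sum]
    refine Finset.sum_congr rfl fun k _ => ?_
    rw [Finset.mul_sum]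
    refine Finset.sum_congr rfl fun l _ => ?_
    unfold monomial
    ring
  simp_rw [hpt]
  have hint : ∀ i j k l : Fin d, Integrable (fun x : Metric.sphere (0 : HX d) 1 =>
      W i j * conj (W k l) * monomial i j k l (x : HX d)) (uniformState d) := fun i j k l =>
    (integrable_monomial i j k l).const_mul _
  have : ∫ x : Metric.sphere (0 : HX d) 1, ∑ i, ∑ j, ∑ k, ∑ l, W i j * conj (W k l) * monomial i j k l (x : HX d)
        ∂(uniformState d) =
      ∑ i, ∑ j, ∑ k, ∑ l, W i j * conj (W k l) * moment d i j k l := by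
    rw [integral_finsetSum]
    · refine Finset.sum_congr rfl fun i _ => ?_
      rw [integral_finsetSum]
      · refine Finset.sum_congr rfl fun j _ => ?_
        rw [integral_finsetSum]
        · refine Finset.sum_congr rfl fun k _ => ?_
          rw [integral_finsetSum]
          · refine Finset.sum_congr rfl fun l _ => ?_
            rw [integral_const_mul]
            rfl
          · exact fun l _ => hint _ _ _ _
        · exact fun k _ => integrable_finsetSum _ fun l _ => hint _ _ _ _
      · exact fun j _ => integrable_finsetSum _ fun k _ => integrable_finsetSum _ fun l _ =>
          hint _ _ _ _
    · exact fun i _ => integrable_finsetSum _ fun j _ => integrable_finsetSum _ fun k _ =>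
        integrable_finsetSum _ fun l _ => hint _ _ _ _
  rw [this]
  have hterm : ∀ i j k l : Fin d, W i j * conj (W k l) * moment d i j k l =
      1 / (d * (d + 1)) * ((if i = j then if k = l then W i j * conj (W k l) else 0 else 0) +
        if i = k then if j = l then W i j * conj (W k l) else 0 else 0) := by
    intro i j k l
    rw [moment_eq]
    simp only [ite_and]
    split_ifs <;> ring
  simp_rw [hterm, ← Finset.mul_sum, Finset.sum_add_distrib]
  -- The pairing `i = j`, `k = l` yields `|tr W|²`; the pairing `i = k`, `j = l` yields `tr (W Wᴴ)`.
  congr 2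
  · simp only [Matrix.trace, Matrix.diag_apply, map_sum, Finset.sum_mul_sum, Finset.sum_ite_irrel,
      Finset.sum_const_zero, Finset.sum_ite_eq, Finset.mem_univ, if_true]
  · simp only [Matrix.trace, Matrix.diag_apply, Matrix.mul_apply, Matrix.conjTranspose_apply,
      Finset.sum_ite_irrel, Finset.sum_const_zero,
      Finset.sum_ite_eq, Finset.mem_univ, if_true, RCLike.star_def]

/-! ### Haar measure on the unitary group. -/

theorem secondCountableTopology_uGroup (d : ℕ) : SecondCountableTopology (UGroup d) :=
  have : SecondCountableTopology (Matrix (Fin d) (Fin d) ℂ) :=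
    inferInstanceAs (SecondCountableTopology (Fin d → Fin d → ℂ))
  Topology.IsEmbedding.subtypeVal.secondCountableTopology

instance instIsHaarMeasureHaarU (d : ℕ) : (haarU d).IsHaarMeasure := by
  unfold haarU; infer_instance

instance instIsProbabilityMeasureHaarU (d : ℕ) : IsProbabilityMeasure (haarU d) :=
  ⟨by
    have := Measure.haarMeasure_self (K₀ := (⊤ : TopologicalSpace.PositiveCompacts (UGroup d)))
    simpa [haarU] using this⟩

/-- A right translate of a left Haar probability measure is again one, and such a measure is unique.
-/
instance instIsMulRightInvariantHaarU (d : ℕ) : (haarU d).IsMulRightInvariant := by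
  refine ⟨fun g => ?_⟩
  have hm : Measurable (fun x : UGroup d => x * g) := (continuous_mul_const g).measurable
  have h1 : IsProbabilityMeasure ((haarU d).map (fun x => x * g)) :=
    Measure.isProbabilityMeasure_map hm.aemeasurable
  have h2 : ((haarU d).map (fun x => x * g)).IsHaarMeasure := by
    exact Measure.isHaarMeasure_map_mul_right (haarU d) g
  exact Measure.isHaarMeasure_eq_of_isProbabilityMeasure _ _

/-! ### Trace distance of pure states. -/

theorem ketbra_mul_ketbra {ι : Type*} [Fintype ι] (y z : EuclideanSpace ℂ ι) :
    ketbra y * ketbra z = inner ℂ y z • Matrix.vecMulVec y.ofLp (star z.ofLp) := by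
  ext i j
  simp only [ketbra, Matrix.mul_apply, Matrix.vecMulVec_apply, Matrix.smul_apply, smul_eq_mul,
    PiLp.inner_apply, RCLike.inner_apply, Finset.sum_mul, Pi.star_apply, RCLike.star_def]
  refine Finset.sum_congr rfl fun k _ => ?_
  ring

theorem ketbra_sandwich {ι : Type*} [Fintype ι] (y z : EuclideanSpace ℂ ι) :
    ketbra y * ketbra z * ketbra y = ((‖inner ℂ y z‖ ^ 2 : ℝ) : ℂ) • ketbra y := by
  rw [ketbra_mul_ketbra, Complex.ofReal_pow, ← Complex.mul_conj']
  rw [inner_conj_symm]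
  ext i j
  simp only [ketbra, Matrix.mul_apply, Matrix.vecMulVec_apply, Matrix.smul_apply, smul_eq_mul,
    PiLp.inner_apply, RCLike.inner_apply, Finset.sum_mul, Finset.mul_sum, Pi.star_apply,
    RCLike.star_def]
  refine Finset.sum_congr rfl fun k _ => Finset.sum_congr rfl fun l _ => ?_
  ring

theorem ketbra_conjTranspose {ι : Type*} (y : EuclideanSpace ℂ ι) : (ketbra y)ᴴ = ketbra y := by
  ext i j
  simp [ketbra, Matrix.vecMulVec_apply, mul_comm]

theorem ketbra_trace {ι : Type*} [Fintype ι] (y : EuclideanSpace ℂ ι) :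
    (ketbra y).trace = inner ℂ y y := by
  simp only [ketbra, Matrix.trace, Matrix.diag_apply, Matrix.vecMulVec_apply, PiLp.inner_apply]
  rfl

open scoped MatrixOrder ComplexOrder in
/-- The trace distance of two pure states. -/
theorem traceDist_ketbra_sq {d : ℕ} {y z : HX d} (hy : ‖y‖ = 1) (hz : ‖z‖ = 1) :
    traceDist (ketbra y) (ketbra z) ^ 2 = 1 - ‖inner ℂ y z‖ ^ 2 := by
  set c : ℝ := ‖inner ℂ y z‖ ^ 2 with hc
  have hc1 : c ≤ 1 := by
    have := norm_inner_le_norm (𝕜 := ℂ) y z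
    rw [hy, hz, mul_one] at this
    exact pow_le_one₀ (norm_nonneg _) this
  set P := ketbra y with hP
  set Q := ketbra z with hQ
  have hPP : P * P = P := by
    rw [hP, ketbra_mul_ketbra, inner_self_eq_norm_sq_to_K, hy]; simp [ketbra]
  have hQQ : Q * Q = Q := by
    rw [hQ, ketbra_mul_ketbra, inner_self_eq_norm_sq_to_K, hz]; simp [ketbra]
  have hPQP : P * Q * P = (c : ℂ) • P := ketbra_sandwich y z
  have hQPQ : Q * P * Q = (c : ℂ) • Q := by
    rw [hc, ← norm_inner_symm]; exact ketbra_sandwich z y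
  have hA : (P - Q)ᴴ = P - Q := by
    rw [Matrix.conjTranspose_sub, hP, hQ, ketbra_conjTranspose, ketbra_conjTranspose]
  have hA2 : (P - Q) * (P - Q) = P + Q - P * Q - Q * P := by
    rw [sub_mul, mul_sub, mul_sub, hPP, hQQ]; abel
  -- This cubic relation replaces diagonalization: the nonzero eigenvalues of `P - Q` can only be
  -- `±√(1 - c)`.
  have hA3 : (P - Q) * (P - Q) * (P - Q) = ((1 - c : ℝ) : ℂ) • (P - Q) := by
    rw [hA2, mul_sub, sub_mul, sub_mul, add_mul, sub_mul, sub_mul, add_mul, hPP, hQQ,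
      mul_assoc Q P P, hPP, mul_assoc P Q Q, hQQ, hPQP, hQPQ]
    push_cast
    module
  have htrPQ : (P * Q).trace = (c : ℂ) := by
    rw [hP, hQ, ketbra_mul_ketbra, Matrix.trace_smul, smul_eq_mul, hc, Complex.ofReal_pow,
      ← Complex.mul_conj', inner_conj_symm]
    congr 1
  have htr : ((P - Q) * (P - Q)).trace = ((2 * (1 - c) : ℝ) : ℂ) := by
    rw [hA2, Matrix.trace_sub, Matrix.trace_sub, Matrix.trace_add, Matrix.trace_mul_comm Q P,
      htrPQ, hP, hQ, ketbra_trace, ketbra_trace, inner_self_eq_norm_sq_to_K,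
      inner_self_eq_norm_sq_to_K, hy, hz]
    push_cast
    ring
  rcases hc1.eq_or_lt with h1 | h1
  · have h0 : ((P - Q)ᴴ * (P - Q)).trace = 0 := by rw [hA, htr, h1]; simp
    have h0' := Matrix.trace_conjTranspose_mul_self_eq_zero_iff.mp h0
    rw [traceDist, h0', h1]
    simp
  · set s := √(1 - c) with hs
    have hs0 : 0 < s := Real.sqrt_pos.mpr (by linarith)
    have hs2 : s ^ 2 = 1 - c := Real.sq_sqrt (by linarith)
    -- The candidate for `|P - Q|`: by the cubic relation `(P - Q)² / s` is a positive square root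
    -- of `(P - Q)²`.
    set B : Matrix (Fin d) (Fin d) ℂ := ((s⁻¹ : ℝ) : ℂ) • ((P - Q) * (P - Q)) with hB
    have hBpos : 0 ≤ B := by
      rw [Matrix.nonneg_iff_posSemidef, hB]
      refine Matrix.PosSemidef.smul ?_ ?_
      · have := Matrix.posSemidef_conjTranspose_mul_self (P - Q)
        rwa [hA] at this
      · exact_mod_cast (inv_pos.mpr hs0).le
    have hBsq : B ^ 2 = (P - Q)ᴴ * (P - Q) := by
      rw [hA, pow_two, hB, smul_mul_smul_comm, ← mul_assoc, hA3, smul_mul_assoc, smul_smul,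
        ← hs2]
      have : ((s⁻¹ : ℝ) : ℂ) * ((s⁻¹ : ℝ) : ℂ) * ((s ^ 2 : ℝ) : ℂ) = 1 := by
        rw [← Complex.ofReal_mul, ← Complex.ofReal_mul]
        norm_cast
        field_simp
      rw [this, one_smul]
    have hBsa : IsSelfAdjoint B := IsSelfAdjoint.of_nonneg hBpos
    have hcfc : cfc Real.sqrt ((P - Q)ᴴ * (P - Q)) = B := by
      rw [← hBsq, ← cfc_pow_id (R := ℝ) B 2, ← cfc_comp' Real.sqrt (fun x : ℝ => x ^ 2) B]
      conv_rhs => rw [← cfc_id ℝ B]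
      refine cfc_congr fun x hx => ?_
      simp only [id]
      exact Real.sqrt_sq (spectrum_nonneg_of_nonneg hBpos hx)
    have hBtr : B.trace = ((2 * s : ℝ) : ℂ) := by
      rw [hB, Matrix.trace_smul, htr, smul_eq_mul, ← hs2, ← Complex.ofReal_mul]
      congr 1
      field_simp
    rw [traceDist, hcfc, hBtr, Complex.ofReal_re, ← hs2]
    ring

/-! ### Unitaries acting on states, and the risk formula. -/

section applyMat

variable {ι : Type*} [Fintype ι]

theorem inner_applyMat_left (A : Matrix ι ι ℂ) (x y : EuclideanSpace ℂ ι) :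
    inner ℂ (applyMat A x) y = inner ℂ x (applyMat Aᴴ y) := by
  simp only [applyMat, EuclideanSpace.inner_eq_star_dotProduct, Matrix.star_mulVec]
  rw [dotProduct_comm, ← Matrix.dotProduct_mulVec, dotProduct_comm]

theorem applyMat_mul (A B : Matrix ι ι ℂ) (x : EuclideanSpace ℂ ι) :
    applyMat (A * B) x = applyMat A (applyMat B x) := by
  simp [applyMat, Matrix.mulVec_mulVec]

theorem applyMat_one [DecidableEq ι] (x : EuclideanSpace ℂ ι) : applyMat 1 x = x := by
  simp [applyMat]

theorem applyMat_sum {κ : Type*} (s : Finset κ) (A : Matrix ι ι ℂ)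
    (x : κ → EuclideanSpace ℂ ι) : applyMat A (∑ k ∈ s, x k) = ∑ k ∈ s, applyMat A (x k) := by
  classical
  exact map_sum (Matrix.toEuclideanLin A) x s

theorem applyMat_smul (A : Matrix ι ι ℂ) (c : ℂ) (x : EuclideanSpace ℂ ι) :
    applyMat A (c • x) = c • applyMat A x := by
  classical
  exact map_smul (Matrix.toEuclideanLin A) c x

theorem inner_applyMat_of_unitary [DecidableEq ι] {A : Matrix ι ι ℂ} (hA : Aᴴ * A = 1)
    (x y : EuclideanSpace ℂ ι) : inner ℂ (applyMat A x) (applyMat A y) = inner ℂ x y := by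
  rw [inner_applyMat_left, ← applyMat_mul, hA, applyMat_one]

theorem norm_applyMat_of_unitary [DecidableEq ι] {A : Matrix ι ι ℂ} (hA : Aᴴ * A = 1)
    (x : EuclideanSpace ℂ ι) : ‖applyMat A x‖ = ‖x‖ := by
  rw [@norm_eq_sqrt_re_inner ℂ, inner_applyMat_of_unitary hA, ← @norm_eq_sqrt_re_inner ℂ]

end applyMat

theorem uGroup_conjTranspose_mul_self {d : ℕ} (U : UGroup d) :
    (U : Matrix (Fin d) (Fin d) ℂ)ᴴ * U = 1 :=
  Matrix.mem_unitaryGroup_iff'.mp U.2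

theorem uGroup_mul_conjTranspose_self {d : ℕ} (U : UGroup d) :
    (U : Matrix (Fin d) (Fin d) ℂ) * (U : Matrix (Fin d) (Fin d) ℂ)ᴴ = 1 :=
  Matrix.mem_unitaryGroup_iff.mp U.2

open scoped ComplexConjugate in
/-- The risk in terms of the overlap of the two unitaries. -/
theorem risk_eq {d : ℕ} [NeZero d] (U V : UGroup d) :
    risk U V = 1 - (‖((U : Matrix (Fin d) (Fin d) ℂ)ᴴ * V).trace‖ ^ 2 + d) /
      ((d : ℝ) * (d + 1)) := by
  set W : Matrix (Fin d) (Fin d) ℂ := (U : Matrix (Fin d) (Fin d) ℂ)ᴴ * V with hW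
  have hWW : W * Wᴴ = 1 := by
    rw [hW, Matrix.conjTranspose_mul, Matrix.conjTranspose_conjTranspose, Matrix.mul_assoc,
      ← Matrix.mul_assoc (V : Matrix (Fin d) (Fin d) ℂ), uGroup_mul_conjTranspose_self,
      Matrix.one_mul, uGroup_conjTranspose_mul_self]
  have hpt : ∀ x : Metric.sphere (0 : HX d) 1,
      (traceDist (ketbra (applyMat (U : Matrix (Fin d) (Fin d) ℂ) x))
        (ketbra (applyMat (V : Matrix (Fin d) (Fin d) ℂ) x))) ^ 2 =
      1 - ‖inner ℂ (x : HX d) (applyMat W x)‖ ^ 2 := by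
    intro x
    rw [traceDist_ketbra_sq, inner_applyMat_left, ← applyMat_mul]
    · rw [norm_applyMat_of_unitary (uGroup_conjTranspose_mul_self U)]; simp
    · rw [norm_applyMat_of_unitary (uGroup_conjTranspose_mul_self V)]; simp
  have hcont : Continuous fun x : Metric.sphere (0 : HX d) 1 =>
      ‖inner ℂ (x : HX d) (applyMat W x)‖ ^ 2 := by
    unfold applyMat
    fun_prop
  have hmean : ∫ x : Metric.sphere (0 : HX d) 1, ‖inner ℂ (x : HX d) (applyMat W x)‖ ^ 2
      ∂(uniformState d) = (‖W.trace‖ ^ 2 + d) / ((d : ℝ) * (d + 1)) := by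
    have h := integral_expectation_normSq W
    rw [integral_complex_ofReal, hWW, Matrix.trace_one, Fintype.card_fin, Complex.mul_conj'] at h
    apply Complex.ofReal_injective
    rw [h]
    push_cast
    ring
  unfold risk
  simp_rw [hpt]
  rw [integral_sub (integrable_const _) (hcont.integrable_of_hasCompactSupport
    (HasCompactSupport.of_compactSpace _)), hmean]
  simp

/-! ### Consequences of perfect training for the Schmidt vectors. -/

section Schmidt

variable {d dR : ℕ}

theorem kronecker_unitary (U : UGroup d) :
    ((U : Matrix (Fin d) (Fin d) ℂ) ⊗ₖ (1 : Matrix (Fin dR) (Fin dR) ℂ))ᴴ *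
      ((U : Matrix (Fin d) (Fin d) ℂ) ⊗ₖ (1 : Matrix (Fin dR) (Fin dR) ℂ)) = 1 := by
  rw [Matrix.conjTranspose_kronecker, ← Matrix.mul_kronecker_mul, uGroup_conjTranspose_mul_self,
    Matrix.conjTranspose_one, Matrix.one_mul, Matrix.one_kronecker_one]

theorem norm_applyX (U : UGroup d) (ψ : HXR d dR) : ‖applyX U ψ‖ = ‖ψ‖ :=
  norm_applyMat_of_unitary (kronecker_unitary U) ψ

theorem applyX_mul (U M : UGroup d) (ψ : HXR d dR) :
    applyX (U * M) ψ = applyX U (applyX M ψ) := by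
  rw [applyX, applyX, applyX, ← applyMat_mul, ← Matrix.mul_kronecker_mul, Matrix.one_mul]
  rfl

theorem applyX_prodState (U : UGroup d) (ξ : HX d) (ζ : EuclideanSpace ℂ (Fin dR)) :
    applyX U (prodState ξ ζ) = prodState (applyMat (U : Matrix (Fin d) (Fin d) ℂ) ξ) ζ := by
  ext p
  simp only [applyX, applyMat, prodState, Matrix.mulVec, dotProduct, Fintype.sum_prod_type,
    Matrix.kroneckerMap_apply, Matrix.one_apply, mul_ite, mul_one, mul_zero, ite_mul, zero_mul,
    Finset.sum_ite_eq, Finset.mem_univ, if_true, Finset.sum_mul, mul_assoc]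

theorem inner_prodState (ξ ξ' : HX d) (ζ ζ' : EuclideanSpace ℂ (Fin dR)) :
    inner ℂ (prodState ξ ζ) (prodState ξ' ζ') = inner ℂ ξ ξ' * inner ℂ ζ ζ' := by
  simp only [prodState, PiLp.inner_apply, Fintype.sum_prod_type, RCLike.inner_apply,
    Finset.sum_mul_sum, map_mul]
  refine Finset.sum_congr rfl fun i _ => Finset.sum_congr rfl fun j _ => ?_
  ring

/-- The partial inner product with a vector of the reference system. -/
noncomputable def contract (ζ : EuclideanSpace ℂ (Fin dR)) : HXR d dR →ₗ[ℂ] HX d where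
  toFun ψ := WithLp.toLp 2 fun i => ∑ j, star (ζ j) * ψ (i, j)
  map_add' ψ φ := by ext i; simp [mul_add, Finset.sum_add_distrib]
  map_smul' c ψ := by ext i; simp [Finset.mul_sum, mul_left_comm]

theorem contract_prodState (ζ ζ' : EuclideanSpace ℂ (Fin dR)) (ξ : HX d) :
    contract ζ (prodState ξ ζ') = (inner ℂ ζ ζ' : ℂ) • ξ := by
  ext i
  simp only [contract, prodState, LinearMap.coe_mk, AddHom.coe_mk, PiLp.smul_apply, smul_eq_mul,
    PiLp.inner_apply, RCLike.inner_apply, Finset.sum_mul, RCLike.star_def]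
  refine Finset.sum_congr rfl fun j _ => ?_
  ring

namespace SchmidtDecomposition

variable {ψ : HXR d dR} (D : SchmidtDecomposition ψ)

theorem applyX_eq (U : UGroup d) : applyX U ψ = ∑ k, ((Real.sqrt (D.coeff k) : ℝ) : ℂ) •
    prodState (applyMat (U : Matrix (Fin d) (Fin d) ℂ) (D.ξ k)) (D.ζ k) := by
  conv_lhs => rw [D.decomp]
  rw [applyX, applyMat_sum]
  refine Finset.sum_congr rfl fun k _ => ?_
  rw [applyMat_smul, ← applyX_prodState]
  rfl

theorem norm_eq_one {ψ : HXR d dR} (D : SchmidtDecomposition ψ) : ‖ψ‖ = 1 := by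
  have hon : Orthonormal ℂ fun k => prodState (D.ξ k) (D.ζ k) := by
    rw [orthonormal_iff_ite]
    intro k l
    rw [inner_prodState, orthonormal_iff_ite.mp D.orthonormal_ξ,
      orthonormal_iff_ite.mp D.orthonormal_ζ]
    split_ifs <;> simp
  have h : (inner ℂ ψ ψ : ℂ) = 1 := by
    conv_lhs => rw [D.decomp]
    rw [hon.inner_sum]
    rw [← Complex.ofReal_one, ← D.coeff_sum, Complex.ofReal_sum]
    refine Finset.sum_congr rfl fun k _ => ?_
    rw [Complex.conj_ofReal, ← Complex.ofReal_mul, Real.mul_self_sqrt (D.coeff_pos k).le]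
  rw [inner_self_eq_norm_sq_to_K] at h
  have h' : ‖ψ‖ ^ 2 = 1 := Complex.ofReal_injective (by simpa using h)
  exact (pow_eq_one_iff_of_nonneg (norm_nonneg ψ) two_ne_zero).mp h'

theorem contract_applyX (U : UGroup d) (k : Fin D.rank) : contract (D.ζ k) (applyX U ψ) =
    ((Real.sqrt (D.coeff k) : ℝ) : ℂ) • applyMat (U : Matrix (Fin d) (Fin d) ℂ) (D.ξ k) := by
  rw [D.applyX_eq U, map_sum, Finset.sum_eq_single k]
  · rw [map_smul, contract_prodState, orthonormal_iff_ite.mp D.orthonormal_ζ]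
    simp
  · intro l _ hl
    rw [map_smul, contract_prodState, orthonormal_iff_ite.mp D.orthonormal_ζ, if_neg hl.symm]
    simp
  · simp

theorem applyX_eq_self {M : UGroup d}
    (hM : ∀ k, applyMat (M : Matrix (Fin d) (Fin d) ℂ) (D.ξ k) = D.ξ k) : applyX M ψ = ψ := by
  rw [D.applyX_eq M]
  conv_rhs => rw [D.decomp]
  simp_rw [hM]

/-- If two unitaries agree up to a phase on a state, then they agree up to the same phase on its
Schmidt vectors. -/
theorem applyMat_ξ_of_applyX {U V : UGroup d} {z : ℂ} (h : applyX V ψ = z • applyX U ψ)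
    (k : Fin D.rank) : applyMat ((U : Matrix (Fin d) (Fin d) ℂ)ᴴ *
      (V : Matrix (Fin d) (Fin d) ℂ)) (D.ξ k) = z • D.ξ k := by
  -- Contraction with `ζ k` isolates the `k`-th Schmidt term on both sides; its coefficient is
  -- positive and cancels, leaving the same `z` for every `k`.
  have h1 := congrArg (contract (D.ζ k)) h
  rw [map_smul, D.contract_applyX, D.contract_applyX, smul_comm] at h1
  have hc : ((Real.sqrt (D.coeff k) : ℝ) : ℂ) ≠ 0 := by
    exact_mod_cast (Real.sqrt_pos.mpr (D.coeff_pos k)).ne'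
  have h2 := smul_right_injective _ hc h1
  rw [applyMat_mul, h2, applyMat_smul, ← applyMat_mul, uGroup_conjTranspose_mul_self,
    applyMat_one]

end SchmidtDecomposition

/-- Perfect training determines the action on the training inputs up to phases. -/
theorem exists_phase_of_loss_eq_zero {t : ℕ} {ψ : Fin t → HXR d dR} {U V : UGroup d}
    (hψ : ∀ j, ‖ψ j‖ = 1) (h : loss (trainingSet U ψ) V = 0) (m : Fin t) :
    ∃ z : ℂ, ‖z‖ = 1 ∧ applyX V (ψ m) = z • applyX U (ψ m) := by
  have ht : (t : ℝ) ≠ 0 := by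
    have := m.pos
    positivity
  have hle : ∀ j ∈ Finset.univ, ‖inner ℂ (applyX U (ψ j)) (applyX V (ψ j))‖ ^ 2 ≤ (1 : ℝ) := by
    intro j _
    have := norm_inner_le_norm (𝕜 := ℂ) (applyX U (ψ j)) (applyX V (ψ j))
    rw [norm_applyX, norm_applyX, hψ, mul_one] at this
    exact pow_le_one₀ (norm_nonneg _) this
  have hsum : ∑ j, ‖inner ℂ (applyX U (ψ j)) (applyX V (ψ j))‖ ^ 2 = ∑ _j : Fin t, (1 : ℝ) := by
    simp only [loss, trainingSet] at h
    field_simp at h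
    simp
    linarith
  -- The squared overlaps are at most 1 and average to 1, so each equals 1. The phase then comes
  -- from the equality case of Cauchy–Schwarz.
  have hm := (Finset.sum_eq_sum_iff_of_le hle).mp hsum m (Finset.mem_univ m)
  have hU : ‖applyX U (ψ m)‖ = 1 := by rw [norm_applyX, hψ]
  have hV : ‖applyX V (ψ m)‖ = 1 := by rw [norm_applyX, hψ]
  have hm' : ‖inner ℂ (applyX U (ψ m)) (applyX V (ψ m))‖ =
      ‖applyX U (ψ m)‖ * ‖applyX V (ψ m)‖ := by
    rw [hU, hV, mul_one]
    exact (pow_eq_one_iff_of_nonneg (norm_nonneg _) two_ne_zero).mp hm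
  obtain ⟨z, -, hz⟩ := (norm_inner_eq_norm_iff (norm_ne_zero_iff.mp (by rw [hU]; simp))
    (norm_ne_zero_iff.mp (by rw [hV]; simp))).mp hm'
  refine ⟨z, ?_, hz⟩
  rw [hz, norm_smul, hU, mul_one] at hV
  exact hV

theorem applyMat_eq_self_of_mem_span {r : ℕ} {ξ : Fin r → HX d} {A : Matrix (Fin d) (Fin d) ℂ}
    (hA : ∀ k, applyMat A (ξ k) = ξ k) {x : HX d}
    (hx : x ∈ Submodule.span ℂ (Set.range ξ)) : applyMat A x = x := by
  have : Set.EqOn (Matrix.toEuclideanLin A) (LinearMap.id : HX d →ₗ[ℂ] HX d)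
      (Submodule.span ℂ (Set.range ξ)) := by
    apply LinearMap.eqOn_span
    rintro _ ⟨k, rfl⟩
    exact hA k
  exact this hx

end Schmidt

/-! ### Averaging over signed cyclic shifts of the complement. -/

theorem sum_signs_normSq : ∀ (n : ℕ) (c : ℂ) (z : Fin n → ℂ),
    ∑ ε : Fin n → ℤˣ, ‖c + ∑ j, ((ε j : ℤ) : ℂ) * z j‖ ^ 2 =
      2 ^ n * (‖c‖ ^ 2 + ∑ j, ‖z j‖ ^ 2)
  | 0, c, z => by simp
  | n + 1, c, z => by
    -- The first sign is split off. Induction applies with constants `c + z 0` and `c - z 0`, and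
    -- the parallelogram law combines the two results.
    rw [← (Fin.consEquiv (fun _ => ℤˣ)).sum_comp, Fintype.sum_prod_type]
    simp only [Fin.consEquiv, Equiv.coe_fn_mk, Fin.sum_univ_succ, Fin.cons_zero, Fin.cons_succ,
      ← add_assoc]
    simp only [sum_signs_normSq n]
    have hu : (Finset.univ : Finset ℤˣ) = {1, -1} := by decide
    rw [hu, Finset.sum_insert (by decide), Finset.sum_singleton]
    have h := parallelogram_law_with_norm ℂ c (z 0)
    simp only [Units.val_one, Units.val_neg, Int.cast_one, Int.cast_neg, one_mul, neg_mul,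
      ← sub_eq_add_neg]
    rw [pow_succ]
    linear_combination 2 ^ n * h

section BasisChange

variable {d : ℕ} {ι : Type*} [DecidableEq ι]

/-- The matrix whose columns are the given vectors. -/
def columnMatrix (b : ι → HX d) : Matrix (Fin d) ι ℂ := Matrix.of fun i m => b m i

theorem columnMatrix_gram {b : ι → HX d} (hb : Orthonormal ℂ b) :
    (columnMatrix b)ᴴ * columnMatrix b = 1 := by
  ext k l
  rw [Matrix.one_apply, ← orthonormal_iff_ite.mp hb k l]
  simp only [columnMatrix, Matrix.mul_apply, Matrix.conjTranspose_apply, Matrix.of_apply,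
    PiLp.inner_apply, RCLike.inner_apply, RCLike.star_def]
  exact Finset.sum_congr rfl fun i _ => mul_comm _ _

variable [Fintype ι]

theorem columnMatrix_gram' (hd : Fintype.card ι = d) {b : ι → HX d} (hb : Orthonormal ℂ b) :
    columnMatrix b * (columnMatrix b)ᴴ = 1 :=
  (Matrix.mul_eq_one_comm_of_card_eq _ _ _ (by simp [hd])).mp (columnMatrix_gram hb)

/-- The unitary that maps one orthonormal basis to another. -/
def basisChange (hd : Fintype.card ι = d) {b b' : ι → HX d} (hb : Orthonormal ℂ b)
    (hb' : Orthonormal ℂ b') : UGroup d :=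
  ⟨columnMatrix b' * (columnMatrix b)ᴴ, by
    rw [Matrix.mem_unitaryGroup_iff, Matrix.star_eq_conjTranspose, Matrix.conjTranspose_mul,
      Matrix.conjTranspose_conjTranspose, Matrix.mul_assoc, ← Matrix.mul_assoc _ (columnMatrix b),
      columnMatrix_gram hb, Matrix.one_mul, columnMatrix_gram' hd hb']⟩

theorem applyMat_basisChange (hd : Fintype.card ι = d) {b b' : ι → HX d} (hb : Orthonormal ℂ b)
    (hb' : Orthonormal ℂ b') (m : ι) :
    applyMat (basisChange hd hb hb' : Matrix (Fin d) (Fin d) ℂ) (b m) = b' m := by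
  have h1 : ∀ (c : ι → HX d), (c m).ofLp = columnMatrix c *ᵥ Pi.single m 1 := by
    intro c
    ext i
    simp [columnMatrix]
  simp only [applyMat, basisChange]
  rw [h1 b, Matrix.mulVec_mulVec, Matrix.mul_assoc, columnMatrix_gram hb, Matrix.mul_one, ← h1 b']

theorem trace_basisChange_mul (hd : Fintype.card ι = d) {b b' : ι → HX d} (hb : Orthonormal ℂ b)
    (hb' : Orthonormal ℂ b') (W : Matrix (Fin d) (Fin d) ℂ) :
    ((basisChange hd hb hb' : Matrix (Fin d) (Fin d) ℂ)ᴴ * W).trace =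
      ∑ m, inner ℂ (b' m) (applyMat W (b m)) := by
  simp only [basisChange]
  rw [Matrix.conjTranspose_mul, Matrix.conjTranspose_conjTranspose, Matrix.mul_assoc,
    Matrix.trace_mul_comm, Matrix.mul_assoc, Matrix.trace]
  refine Finset.sum_congr rfl fun m _ => ?_
  simp only [Matrix.diag_apply, Matrix.mul_apply, columnMatrix, Matrix.conjTranspose_apply,
    Matrix.of_apply, PiLp.inner_apply, RCLike.inner_apply, applyMat, Matrix.mulVec, dotProduct,
    RCLike.star_def]
  exact Finset.sum_congr rfl fun i _ => mul_comm _ _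

end BasisChange

theorem exists_orthonormal_extension {d r : ℕ} {ξ : Fin r → HX d} (hξ : Orthonormal ℂ ξ) :
    ∃ (n : ℕ) (b : Fin r ⊕ Fin n → HX d), r + n = d ∧ Orthonormal ℂ b ∧
      ∀ k, b (Sum.inl k) = ξ k := by
  have hr : r ≤ d := by
    simpa using hξ.linearIndependent.fintype_card_le_finrank
  have hcard : Module.finrank ℂ (HX d) = Fintype.card (Fin r ⊕ Fin (d - r)) := by
    simp; omega
  have hon : Orthonormal ℂ ((Set.range (Sum.inl : Fin r → Fin r ⊕ Fin (d - r))).domRestrict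
      (Sum.elim ξ fun _ => 0)) := by
    rw [orthonormal_iff_ite]
    rintro ⟨_, k, rfl⟩ ⟨_, l, rfl⟩
    simpa [Subtype.ext_iff] using orthonormal_iff_ite.mp hξ k l
  obtain ⟨b, hb⟩ := hon.exists_orthonormalBasis_extension_of_card_eq hcard
  exact ⟨d - r, b, by omega, b.orthonormal, fun k => by simpa using hb (Sum.inl k) ⟨k, rfl⟩⟩

section Twist

variable {d r n : ℕ}

/-- Signs and a permutation applied to the second block of a family of vectors. -/
def twist (b : Fin r ⊕ Fin n → HX d) (ε : Fin n → ℤˣ) (σ : Equiv.Perm (Fin n)) :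
    Fin r ⊕ Fin n → HX d :=
  Sum.elim (fun k => b (Sum.inl k)) fun j => ((ε j : ℤ) : ℂ) • b (Sum.inr (σ j))

theorem orthonormal_twist {b : Fin r ⊕ Fin n → HX d} (hb : Orthonormal ℂ b) (ε : Fin n → ℤˣ)
    (σ : Equiv.Perm (Fin n)) : Orthonormal ℂ (twist b ε σ) := by
  have h := orthonormal_iff_ite.mp hb
  rw [orthonormal_iff_ite]
  rintro (k | j) (l | i)
  · simpa [twist] using h (Sum.inl k) (Sum.inl l)
  · simp [twist, inner_smul_right, h]
  · simp [twist, inner_smul_left, h]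
  · by_cases hij : j = i
    · subst hij
      rcases Int.units_eq_one_or (ε j) with he | he <;>
        simp [twist, he, hb.1]
    · simp [twist, inner_smul_left, inner_smul_right, h, hij]

/-- Up to the factor `2 ^ n` from the signs, each of the `n` shifts contributes `r²`, and each of
the `n` columns contributes at most 1 over all shifts. -/
theorem sum_normSq_trace_twist_le [NeZero n] {b : Fin r ⊕ Fin n → HX d} (hb : Orthonormal ℂ b)
    (hd : Fintype.card (Fin r ⊕ Fin n) = d) {W : Matrix (Fin d) (Fin d) ℂ} (hW : Wᴴ * W = 1)
    {z : ℂ} (hz : ‖z‖ = 1) (hWb : ∀ k, applyMat W (b (Sum.inl k)) = z • b (Sum.inl k)) :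
    ∑ a : Fin n, ∑ ε : Fin n → ℤˣ, ‖((basisChange hd hb
      (orthonormal_twist hb ε (Equiv.addRight a)) : Matrix (Fin d) (Fin d) ℂ)ᴴ * W).trace‖ ^ 2 ≤
      n * 2 ^ n * ((r : ℝ) ^ 2 + 1) := by
  have hterm : ∀ (a : Fin n) (ε : Fin n → ℤˣ), ((basisChange hd hb
      (orthonormal_twist hb ε (Equiv.addRight a)) : Matrix (Fin d) (Fin d) ℂ)ᴴ * W).trace =
      r * z + ∑ j, ((ε j : ℤ) : ℂ) *
        inner ℂ (b (Sum.inr (j + a))) (applyMat W (b (Sum.inr j))) := by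
    intro a ε
    rw [trace_basisChange_mul, Fintype.sum_sum_type]
    congr 1
    · simp [twist, hWb, inner_self_eq_norm_sq_to_K, hb.1]
    · simp [twist, mul_comm]
  have hcol : ∀ j : Fin n,
      ∑ a : Fin n, ‖inner ℂ (b (Sum.inr (j + a))) (applyMat W (b (Sum.inr j)))‖ ^ 2 ≤ 1 := by
    intro j
    refine (Equiv.sum_comp (Equiv.addLeft j)
      (fun i => ‖inner ℂ (b (Sum.inr i)) (applyMat W (b (Sum.inr j)))‖ ^ 2)).trans_le ?_
    have hb2 : Orthonormal ℂ fun i : Fin n => b (Sum.inr i) := hb.comp _ Sum.inr_injective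
    have h := hb2.sum_inner_products_le (s := Finset.univ) (applyMat W (b (Sum.inr j)))
    rwa [norm_applyMat_of_unitary hW, hb.1, one_pow] at h
  simp_rw [hterm, sum_signs_normSq, ← Finset.mul_sum, Finset.sum_add_distrib]
  rw [Finset.sum_comm]
  have h2 := Finset.sum_le_sum fun j (_ : j ∈ Finset.univ) => hcol j
  simp only [Finset.sum_const, Finset.card_univ, Fintype.card_fin, nsmul_eq_mul, mul_one,
    norm_mul, Complex.norm_natCast, hz] at h2 ⊢
  have h3 : (0 : ℝ) ≤ 2 ^ n := by positivity
  calc _ ≤ 2 ^ n * (n * (r : ℝ) ^ 2 + n) := by gcongr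
    _ = _ := by ring

end Twist

/-- The mean squared overlap of the target with a hypothesis that is exact up to a phase on `r`
orthonormal vectors and blind to the action of the target on their orthogonal complement. -/
theorem integral_normSq_trace_le {d r : ℕ} {ξ : Fin r → HX d} (hξ : Orthonormal ℂ ξ)
    {V : UGroup d → UGroup d} (hV : Measurable V)
    (hinv : ∀ U M : UGroup d, (∀ k, applyMat (M : Matrix (Fin d) (Fin d) ℂ) (ξ k) = ξ k) →
      V (U * M) = V U)
    (hW : ∀ᵐ U : UGroup d ∂(haarU d), ∃ z : ℂ, ‖z‖ = 1 ∧
      ∀ k, applyMat ((U : Matrix (Fin d) (Fin d) ℂ)ᴴ * (V U : Matrix (Fin d) (Fin d) ℂ)) (ξ k) = z • ξ k) :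
    ∫ U : UGroup d, ‖((U : Matrix (Fin d) (Fin d) ℂ)ᴴ * (V U : Matrix (Fin d) (Fin d) ℂ)).trace‖ ^ 2 ∂(haarU d) ≤ (r : ℝ) ^ 2 + 1 := by
  obtain ⟨n, b, hrn, hb, hbξ⟩ := exists_orthonormal_extension hξ
  have hd : Fintype.card (Fin r ⊕ Fin n) = d := by simpa using hrn
  have hunit : ∀ U : UGroup d, ((U : Matrix (Fin d) (Fin d) ℂ)ᴴ * (V U : Matrix (Fin d) (Fin d) ℂ))ᴴ *
      ((U : Matrix (Fin d) (Fin d) ℂ)ᴴ * (V U : Matrix (Fin d) (Fin d) ℂ)) = 1 := fun U =>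
    uGroup_conjTranspose_mul_self (U⁻¹ * V U)
  have hcont : Continuous fun p : UGroup d × UGroup d =>
      ‖((p.1 : Matrix (Fin d) (Fin d) ℂ)ᴴ * (p.2 : Matrix (Fin d) (Fin d) ℂ)).trace‖ ^ 2 := by fun_prop
  -- Makes the Borel sigma-algebra of `U(d) × U(d)` the product one, so that continuous functions of
  -- a pair of unitaries compose with measurable maps into the factors.
  have := secondCountableTopology_uGroup d
  obtain ⟨C, hC⟩ := (isCompact_range hcont).isBounded.exists_norm_le
  have hint : ∀ M : UGroup d, Integrable (fun U : UGroup d =>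
      ‖(((U * M : UGroup d) : Matrix (Fin d) (Fin d) ℂ)ᴴ *
        (V (U * M) : Matrix (Fin d) (Fin d) ℂ)).trace‖ ^ 2) (haarU d) := by
    intro M
    refine Integrable.of_bound (C := C) ?_ (ae_of_all _ fun U => hC _ ⟨(U * M, V (U * M)), rfl⟩)
    have hm : Measurable fun U : UGroup d => U * M := (continuous_mul_const M).measurable
    exact (hcont.measurable.comp (hm.prodMk (hV.comp hm))).aestronglyMeasurable
  rcases Nat.eq_zero_or_pos n with hn | hn
  · subst hn
    calc _ = ∫ U : UGroup d, (r : ℝ) ^ 2 ∂(haarU d) := by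
          refine integral_congr_ae ?_
          filter_upwards [hW] with U ⟨z, hz, hU⟩
          -- With no complement, `basisChange` from `b` to itself is the identity, and this formula
          -- computes the trace in the basis `b`: it equals `r z`.
          have h1 := trace_basisChange_mul hd hb hb ((U : Matrix (Fin d) (Fin d) ℂ)ᴴ * (V U : Matrix (Fin d) (Fin d) ℂ))
          have h2 : (basisChange hd hb hb : Matrix (Fin d) (Fin d) ℂ) = 1 :=
            columnMatrix_gram' hd hb
          rw [h2, Matrix.conjTranspose_one, Matrix.one_mul] at h1
          rw [h1]
          simp [hbξ, hU, inner_self_eq_norm_sq_to_K, hξ.1, hz]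
      _ ≤ _ := by simp
  · have : NeZero n := ⟨hn.ne'⟩
    set M : Fin n → (Fin n → ℤˣ) → UGroup d := fun a ε =>
      basisChange hd hb (orthonormal_twist hb ε (Equiv.addRight a)) with hM
    have hMξ : ∀ a ε k, applyMat (M a ε : Matrix (Fin d) (Fin d) ℂ) (ξ k) = ξ k := by
      intro a ε k
      rw [← hbξ, hM, applyMat_basisChange]
      rfl
    -- Right invariance of Haar measure, applied separately for each `M a ε`.
    have hsum : ∑ _a : Fin n, ∑ _ε : Fin n → ℤˣ, ∫ U : UGroup d,
        ‖((U : Matrix (Fin d) (Fin d) ℂ)ᴴ * (V U : Matrix (Fin d) (Fin d) ℂ)).trace‖ ^ 2 ∂(haarU d) =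
        ∫ U : UGroup d, ∑ a, ∑ ε,
          ‖(((U * M a ε : UGroup d) : Matrix (Fin d) (Fin d) ℂ)ᴴ *
            (V (U * M a ε) : Matrix (Fin d) (Fin d) ℂ)).trace‖ ^ 2
          ∂(haarU d) := by
      rw [integral_finsetSum _ fun a _ => integrable_finsetSum _ fun ε _ => hint _]
      refine Finset.sum_congr rfl fun a _ => ?_
      rw [integral_finsetSum _ fun ε _ => hint _]
      refine Finset.sum_congr rfl fun ε _ => ?_
      exact (integral_mul_right_eq_self (μ := haarU d) (fun U : UGroup d =>
        ‖((U : Matrix (Fin d) (Fin d) ℂ)ᴴ * (V U : Matrix (Fin d) (Fin d) ℂ)).trace‖ ^ 2) (M a ε)).symm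
    have hle : ∫ U : UGroup d, ∑ a, ∑ ε,
          ‖(((U * M a ε : UGroup d) : Matrix (Fin d) (Fin d) ℂ)ᴴ *
            (V (U * M a ε) : Matrix (Fin d) (Fin d) ℂ)).trace‖ ^ 2
          ∂(haarU d) ≤ ∫ U : UGroup d, n * 2 ^ n * ((r : ℝ) ^ 2 + 1) ∂(haarU d) := by
      refine integral_mono_ae (integrable_finsetSum _ fun a _ => integrable_finsetSum _ fun ε _ =>
        hint _) (integrable_const _) ?_
      filter_upwards [hW] with U ⟨z, hz, hU⟩
      have h1 := sum_normSq_trace_twist_le hb hd (hunit U) hz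
        (fun k => by rw [hbξ]; exact hU k)
      refine le_trans (le_of_eq ?_) h1
      refine Finset.sum_congr rfl fun a _ => Finset.sum_congr rfl fun ε _ => ?_
      rw [hinv U (M a ε) (hMξ a ε), ← Matrix.mul_assoc, ← Matrix.conjTranspose_mul]
      rfl
    rw [← hsum] at hle
    simp only [Finset.sum_const, Finset.card_univ, Fintype.card_fin, Fintype.card_pi,
      Finset.prod_const, Fintype.card_units_int, nsmul_eq_mul, integral_const, probReal_univ,
      one_smul, Nat.cast_pow, Nat.cast_ofNat, ← mul_assoc] at hle
    exact le_of_mul_le_mul_left hle (by positivity)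

/-! ### Measurability, fixed training inputs, and integration over them. -/

variable {d dR t : ℕ}

theorem continuous_applyX :
    Continuous fun p : UGroup d × HXR d dR => applyX p.1 p.2 := by
  have h : Continuous fun p : UGroup d × HXR d dR =>
      ((p.1 : Matrix (Fin d) (Fin d) ℂ) ⊗ₖ (1 : Matrix (Fin dR) (Fin dR) ℂ)) := by
    refine continuous_matrix fun i j => ?_
    exact ((continuous_subtype_val.comp continuous_fst).matrix_elem i.1 j.1).mul continuous_const
  unfold applyX applyMat
  fun_prop

theorem continuous_applyX_comp {α : Type*} [TopologicalSpace α] {f : α → UGroup d}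
    {g : α → HXR d dR} (hf : Continuous f) (hg : Continuous g) :
    Continuous fun a => applyX (f a) (g a) := by
  have h := continuous_applyX.comp (hf.prodMk hg)
  exact h

theorem continuous_trainingSet :
    Continuous fun p : UGroup d × (Fin t → HXR d dR) => trainingSet p.1 p.2 :=
  continuous_pi fun j =>
    have h : Continuous fun p : UGroup d × (Fin t → HXR d dR) => p.2 j :=
      (continuous_apply j).comp continuous_snd
    h.prodMk (continuous_applyX_comp continuous_fst h)

theorem continuous_loss :
    Continuous fun p : (Fin t → HXR d dR × HXR d dR) × UGroup d => loss p.1 p.2 := by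
  unfold loss
  refine continuous_const.sub (continuous_const.mul (continuous_finsetSum _ fun j _ => ?_))
  have h : Continuous fun p : (Fin t → HXR d dR × HXR d dR) × UGroup d => p.1 j :=
    (continuous_apply j).comp continuous_fst
  exact (h.snd.inner (continuous_applyX_comp continuous_snd h.fst)).norm.pow 2

theorem trainingSet_mul_eq {ψ : Fin t → HXR d dR} {M : UGroup d}
    (hM : ∀ j, applyX M (ψ j) = ψ j) (U : UGroup d) : trainingSet (U * M) ψ = trainingSet U ψ := by
  ext1 j
  simp only [trainingSet, applyX_mul, hM]

/-- The mean risk over all targets for fixed training inputs. -/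
theorem le_integral_risk [NeZero d] {r : ℕ} {ψ : Fin t → HXR d dR} (hψ : IsMinimalSpan r ψ)
    {V : (Fin t → HXR d dR × HXR d dR) → UGroup d} (hV : Measurable V)
    (hperfect : ∀ᵐ U ∂(haarU d), loss (trainingSet U ψ) (V (trainingSet U ψ)) = 0) :
    1 - ((r : ℝ) ^ 2 + d + 1) / ((d : ℝ) * (d + 1)) ≤
      ∫ U, risk U (V (trainingSet U ψ)) ∂(haarU d) := by
  obtain ⟨D, m, rfl, -, hspan⟩ := hψ
  have := secondCountableTopology_uGroup d
  have hS : Measurable fun U : UGroup d => V (trainingSet U ψ) :=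
    hV.comp (continuous_trainingSet.comp
      (by fun_prop : Continuous fun U : UGroup d => (U, ψ))).measurable
  have hle := integral_normSq_trace_le (D m).orthonormal_ξ hS
    -- The span condition enters here: fixing the Schmidt vectors of input `m` fixes those of all
    -- inputs, hence all samples.
    (fun U M hM => by
      rw [trainingSet_mul_eq fun j => (D j).applyX_eq_self fun k =>
        applyMat_eq_self_of_mem_span hM (hspan j k)])
    (by
      filter_upwards [hperfect] with U hU
      obtain ⟨z, hz, h⟩ := exists_phase_of_loss_eq_zero (fun j => (D j).norm_eq_one) hU m
      exact ⟨z, hz, (D m).applyMat_ξ_of_applyX h⟩)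
  have hcont : Continuous fun p : UGroup d × UGroup d =>
      ‖((p.1 : Matrix (Fin d) (Fin d) ℂ)ᴴ * (p.2 : Matrix (Fin d) (Fin d) ℂ)).trace‖ ^ 2 := by
    fun_prop
  obtain ⟨C, hC⟩ := (isCompact_range hcont).isBounded.exists_norm_le
  have hint : Integrable (fun U : UGroup d => ‖((U : Matrix (Fin d) (Fin d) ℂ)ᴴ *
      (V (trainingSet U ψ) : Matrix (Fin d) (Fin d) ℂ)).trace‖ ^ 2) (haarU d) :=
    Integrable.of_bound (C := C) (hcont.measurable.comp
      (measurable_id.prodMk hS)).aestronglyMeasurable (ae_of_all _ fun U => hC _ ⟨(U, _), rfl⟩)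
  have hint' : Integrable (fun U : UGroup d => ‖((U : Matrix (Fin d) (Fin d) ℂ)ᴴ *
      (V (trainingSet U ψ) : Matrix (Fin d) (Fin d) ℂ)).trace‖ ^ 2 + (d : ℝ)) (haarU d) :=
    hint.add (integrable_const _)
  simp_rw [risk_eq]
  rw [integral_sub (integrable_const _) (hint'.div_const _),
    integral_div, integral_add hint (integrable_const _)]
  simp only [integral_const, probReal_univ, one_smul]
  gcongr 1 - ?_ / _
  linarith

/-- By `risk_eq` the risk is continuous on the compact space `U(d) × U(d)`, hence bounded;
measurability of `V` then suffices for Fubini. -/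
theorem integrable_risk [NeZero d] (μ : Measure (Fin t → HXR d dR)) [IsProbabilityMeasure μ]
    {V : (Fin t → HXR d dR × HXR d dR) → UGroup d} (hV : Measurable V) :
    Integrable (Function.uncurry fun U ψ => risk U (V (trainingSet U ψ)))
      ((haarU d).prod μ) := by
  have := secondCountableTopology_uGroup d
  have hcont : Continuous fun p : UGroup d × UGroup d => risk p.1 p.2 := by
    simp_rw [risk_eq]
    fun_prop
  obtain ⟨C, hC⟩ := (isCompact_range hcont).isBounded.exists_norm_le
  exact Integrable.of_bound (C := C) (hcont.measurable.comp (measurable_fst.prodMk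
    (hV.comp continuous_trainingSet.measurable))).aestronglyMeasurable
    (ae_of_all _ fun p => hC _ ⟨(p.1, _), rfl⟩)

theorem IsMinimalSpan.dim_ne_zero {r : ℕ} {ψ : Fin t → HXR d dR} (hψ : IsMinimalSpan r ψ) :
    d ≠ 0 := by
  rintro rfl
  obtain ⟨D, m, -⟩ := hψ
  have h := (D m).norm_eq_one
  rw [Subsingleton.elim (ψ m) 0, norm_zero] at h
  exact zero_ne_one h

end QNFL

theorem mainTheorem2 (d dR t r : ℕ)
    -- the distribution of the training inputs
    (μ : Measure (Fin t → HXR d dR)) [IsProbabilityMeasure μ]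
    (hμ : ∀ᵐ ψ ∂μ, IsMinimalSpan r ψ)
    -- the training algorithm, which sees the training samples only, and trains perfectly
    (V : (Fin t → HXR d dR × HXR d dR) → UGroup d) (hV : Measurable V)
    (hperfect : ∀ᵐ U ∂(haarU d), ∀ᵐ ψ ∂μ, loss (trainingSet U ψ) (V (trainingSet U ψ)) = 0) :
    1 - ((r : ℝ) ^ 2 + d + 1) / ((d : ℝ) * (d + 1)) ≤
      ∫ U, ∫ ψ, risk U (V (trainingSet U ψ)) ∂μ ∂(haarU d) := by
  -- A single admissible family of inputs already contains a unit vector, so `d ≠ 0`.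
  obtain ⟨ψ₀, hψ₀⟩ := hμ.exists
  have : NeZero d := ⟨hψ₀.dim_ne_zero⟩
  have := secondCountableTopology_uGroup d
  -- Needed to exchange the two almost-everywhere quantifiers: for almost every `ψ`, training is
  -- perfect for almost every `U`.
  have hmeas : MeasurableSet {p : UGroup d × (Fin t → HXR d dR) |
      loss (trainingSet p.1 p.2) (V (trainingSet p.1 p.2)) = 0} := by
    have hS := (continuous_trainingSet (d := d) (dR := dR) (t := t)).measurable
    exact (continuous_loss.measurable.comp (hS.prodMk (hV.comp hS))) (measurableSet_singleton 0)
  rw [Measure.ae_ae_comm hmeas] at hperfect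
  have hint := integrable_risk μ hV
  rw [integral_integral_swap hint]
  calc 1 - ((r : ℝ) ^ 2 + d + 1) / ((d : ℝ) * (d + 1))
      = ∫ _ψ, 1 - ((r : ℝ) ^ 2 + d + 1) / ((d : ℝ) * (d + 1)) ∂μ := by simp
    _ ≤ _ := by
      refine integral_mono_ae (integrable_const _) hint.integral_prod_right ?_
      filter_upwards [hμ, hperfect] with ψ h1 h2
      exact le_integral_risk h1 hV h2
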